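/- For positive integers $\alpha_1,\dots,\alpha_m$ define the graph $C(\alpha_1,\dots,\alpha_m)$ recursively: $C(\alpha_1)=\overline{K}_{\alpha_1}$ is the edgeless graph on $\alpha_1$ vertices, and for $2\le i\le m$ the graph $C(\alpha_1,\dots,\alpha_i)$ is the complement of the disjoint union of $C(\alpha_1,\dots,\alpha_{i-1})$ and the complete graph $K_{\alpha_i}$. Let $k\ge 1$, let $\alpha_1,\dots,\alpha_{2k}$ be positive integers, let $G=C(\alpha_1,\dots,\alpha_{2k})$, and let $\alpha_{\min}=\min_{1\le i\le 2k}\alpha_i$. Eigenvalues of $G$ are those of its adjacency matrix. 1. If $(k,\alpha_2)\neq(1,1)$, then $G$ has an eigenvalue smaller than $-1$. Whenever such an eigenvalue exists, the largest one, $\lambda^-(G)$, satisfies $$\lambda^-(G)<\frac{-1-\sqrt2}{2}.$$ 2. $G$ has a positive eigenvalue, and the least one, $\lambda_+(G)$, satisfies $$\lambda_+(G)>\frac{-1+\sqrt2}{2}\,\alpha_{\min}.$$ 3. No eigenvalue of $G$ other than $0$ and $-1$ lies in the closed interval $$\left[\frac{-1-\sqrt2}{2},\ \frac{-1+\sqrt2}{2}\,\alpha_{\min}\right].$$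 -/

import Mathlib

/-- The vertex set of `C(α 1, …, α m)`: it grows by a block of `α i` new vertices in step `i`.
Only the values `α 1, …, α m` are used; the case `m = 0` (no vertices) is a convention. -/
def CVertex (α : ℕ → ℕ) : ℕ → Type
  | 0 => Empty
  | 1 => Fin (α 1)
  | m + 2 => CVertex α (m + 1) ⊕ Fin (α (m + 2))

instance CVertex.instFintype (α : ℕ → ℕ) : (m : ℕ) → Fintype (CVertex α m)
  | 0 => inferInstanceAs (Fintype Empty)
  | 1 => inferInstanceAs (Fintype (Fin (α 1)))
  | m + 2 =>
    letI := CVertex.instFintype α (m + 1)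
    inferInstanceAs (Fintype (CVertex α (m + 1) ⊕ Fin (α (m + 2))))

/-- The cograph `C(α 1, …, α m)`: `C(α 1)` is the graph without edges on `α 1` vertices, and
`C(α 1, …, α i)` is the complement of the disjoint union of `C(α 1, …, α (i - 1))` and the
complete graph on `α i` vertices. -/
def CGraph (α : ℕ → ℕ) : (m : ℕ) → SimpleGraph (CVertex α m)
  | 0 => (⊥ : SimpleGraph Empty)
  | 1 => (⊥ : SimpleGraph (Fin (α 1)))
  | m + 2 => (SimpleGraph.sum (CGraph α (m + 1)) (⊤ : SimpleGraph (Fin (α (m + 2)))))ᶜ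

open Classical in
/-- The set of eigenvalues of the (real) adjacency matrix of a finite graph. -/
def adjEigenvalues {V : Type*} [Fintype V] (G : SimpleGraph V) : Set ℝ :=
  {μ | Module.End.HasEigenvalue (Matrix.toLin' (G.adjMatrix ℝ)) μ}

/-! Two steps of the recursion turn `G` into the disjoint union of `G` and `K_a`, joined to `b`
independent vertices. On an inner graph an eigenvector for `μ` solves `A v + t·1 = μ v`, where `t`
is the sum of the outer entries adjacent to the whole inner graph. With `S` the sum of `v` inside,
only the ratio `r = (S + t) / t` passes outward: it is `1` for the empty graph, and a pair of blocks
maps it to `1 / (1 / (r + a/(μ+1-a)) - b/(μ+b))`.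

If a set `R` containing `1` is preserved by these maps, with no vanishing denominator, then every
nonzero solution has `t ≠ 0`. An eigenvector of the whole graph has `t = 0`, so `μ` is not an
eigenvalue. Such `R` are given for `μ` in the three pieces of the interval cut out by `-1` and `0`.

Rayleigh quotients on an edge and on an induced path supply the positive eigenvalue and the one
below `-1`; as the excluded interval is closed, the bounds are strict. -/

/-- Passing a clique block of size `a` and then an independent block of size `b` transforms the
ratio `r` of (inner sum + outer sum) to outer sum; the set `R` of ratios is preserved, without
a vanishing denominator. -/
def RatioInvariant (μ : ℝ) (P : ℕ → Prop) (R : Set ℝ) : Prop :=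
  ∀ a b : ℕ, P a → P b → ∀ r ∈ R, μ + 1 - a ≠ 0 ∧ μ + b ≠ 0 ∧ r + a / (μ + 1 - a) ≠ 0 ∧
    (r + a / (μ + 1 - a))⁻¹ - b / (μ + b) ≠ 0 ∧
    ((r + a / (μ + 1 - a))⁻¹ - b / (μ + b))⁻¹ ∈ R

/-! ### Invariant ratio sets for the three ranges of `μ` -/

theorem ratioInvariant_of_pos {μ s w : ℝ} (hμ : 0 < μ) (hs : s = (-1 + √2) / 2)
    (hw : w = 1 + √2) :
    RatioInvariant μ (fun a => 1 ≤ a ∧ μ ≤ s * a) {r | r = 1 ∨ -w < r ∧ r < 0} := by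
  have h2 : √2 ^ 2 = 2 := Real.sq_sqrt (by norm_num)
  have h1 : 1.4 < √2 := Real.lt_sqrt_of_sq_lt (by norm_num)
  have hsw : s * w = 1 / 2 := by rw [hs, hw]; linear_combination h2 / 2
  have hw0 : 0 < w := by rw [hw]; linarith
  have hs0 : 0 < s := by rw [hs]; linarith
  have hsw' : 1 + s = w / 2 := by rw [hs, hw]; ring
  rintro a b ⟨ha, hμa⟩ ⟨hb, hμb⟩ r hr
  have hb' : (1 : ℝ) ≤ b := by exact_mod_cast hb
  have ha' : (1 : ℝ) ≤ a := by exact_mod_cast ha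
  have hr1 : r ≤ 1 := by rcases hr with h | h <;> linarith [h]
  have hrw : -w < r := by rcases hr with h | h <;> linarith [h]
  -- Since `μ ≤ s b`, the quotient is at least `1 / (1 + s) = 2 / w`.
  have hd : 2 * w⁻¹ ≤ b / (μ + b) := by
    rw [← div_eq_mul_inv, div_le_div_iff₀ hw0 (by linarith)]
    nlinarith
  have hwi : 0 < w⁻¹ := inv_pos.2 hw0
  -- Subtracting at least `2/w` from a number below `1/w` leaves less than `-1/w`, whose inverse
  -- lies in `(-w, 0)`.
  suffices H : μ + 1 - a ≠ 0 ∧ r + a / (μ + 1 - a) ≠ 0 ∧ (r + a / (μ + 1 - a))⁻¹ < w⁻¹ by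
    obtain ⟨h₁, h₂, h₃⟩ := H
    have hq : (r + a / (μ + 1 - a))⁻¹ - b / (μ + b) < -w⁻¹ := by linarith
    refine ⟨h₁, by linarith, h₂, by linarith, Or.inr ⟨?_, inv_lt_zero.2 (by linarith)⟩⟩
    have := (inv_lt_inv_of_neg (neg_lt_zero.2 hwi) (by linarith)).2 hq
    rwa [inv_neg, inv_inv] at this
  -- Only `a = 1` makes the clique term positive; then `1/μ ≥ 1/s = 2w` outweighs `r > -w`.
  rcases ha.eq_or_lt with rfl | ha2
  · have hc : 2 * w ≤ 1 / μ := by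
      rw [le_div_iff₀ hμ]
      push_cast at hμa
      nlinarith
    have he : ((1 : ℕ) : ℝ) / (μ + 1 - (1 : ℕ)) = 1 / μ := by push_cast; ring_nf
    rw [he]
    refine ⟨by push_cast; linarith, by linarith, ?_⟩
    exact (inv_lt_inv₀ (by linarith) hw0).2 (by linarith)
  · have ha2' : (2 : ℝ) ≤ a := by exact_mod_cast ha2
    have hlt : μ + 1 - a < 0 := by rw [hs] at hμa; nlinarith
    have hc : a / (μ + 1 - a) < -1 := by
      rw [div_lt_iff_of_neg hlt]
      linarith
    refine ⟨hlt.ne, by linarith, ?_⟩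
    exact (inv_lt_zero.2 (by linarith)).trans hwi

theorem ratioInvariant_of_mem_Ioo {μ : ℝ} (hμ : -1 < μ) (hμ0 : μ < 0) :
    RatioInvariant μ (fun a => 1 ≤ a) {r | r = 1 ∨ r < 0} := by
  intro a b ha hb r hr
  have hb' : (1 : ℝ) ≤ b := by exact_mod_cast hb
  have ha' : (1 : ℝ) ≤ a := by exact_mod_cast ha
  have hr1 : r ≤ 1 := by rcases hr with h | h <;> linarith [h]
  have hlt : μ + 1 - a < 0 := by linarith
  have hc : a / (μ + 1 - a) < -1 := by
    rw [div_lt_iff_of_neg hlt]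
    linarith
  have hd : 0 < b / (μ + b) := div_pos (by linarith) (by linarith)
  have hi : (r + a / (μ + 1 - a))⁻¹ < 0 := inv_lt_zero.2 (by linarith)
  exact ⟨hlt.ne, by linarith, by linarith, by linarith, Or.inr (inv_lt_zero.2 (by linarith))⟩

theorem ratioInvariant_of_lt_neg_one {μ w : ℝ} (hμ : μ < -1) (hμ' : (-1 - √2) / 2 ≤ μ)
    (hw : w = 1 + √2) :
    RatioInvariant μ (fun a => 1 ≤ a) {r | r = 1 ∨ r < w⁻¹} := by
  have h2 : √2 ^ 2 = 2 := Real.sq_sqrt (by norm_num)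
  have h1 : 1.4 < √2 := Real.lt_sqrt_of_sq_lt (by norm_num)
  have h3 : √2 < 1.42 := (Real.sqrt_lt' (by norm_num)).2 (by norm_num)
  have hw0 : 0 < w := by rw [hw]; linarith
  have hwi : w⁻¹ = √2 - 1 := by
    rw [hw]; exact inv_eq_of_mul_eq_one_right (by linear_combination h2)
  have hwi0 : 0 < w⁻¹ := inv_pos.2 hw0
  intro a b ha hb r hr
  have hb' : (1 : ℝ) ≤ b := by exact_mod_cast hb
  have ha' : (1 : ℝ) ≤ a := by exact_mod_cast ha
  have hlt : μ + 1 - a < 0 := by linarith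
  have hc1 : -1 < a / (μ + 1 - a) := by
    rw [lt_div_iff_of_neg hlt]
    linarith
  -- The extreme case is `a = 1` at the endpoint `μ = -w/2`.
  have hc2 : a / (μ + 1 - a) ≤ -2 * w⁻¹ := by
    rw [div_le_iff_of_neg hlt, hwi]
    nlinarith
  -- `μ + b` is negative only for `b = 1`, and there `μ + 1 ≥ -1/(2w)`.
  have hd : (μ + b ≠ 0) ∧ (b / (μ + b) ≤ -2 * w ∨ 1 < b / (μ + b) ∧ b / (μ + b) < 1 + w) := by
    rcases hb.eq_or_lt with rfl | hb2
    · have : μ + ((1 : ℕ) : ℝ) < 0 := by push_cast; linarith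
      refine ⟨this.ne, Or.inl ?_⟩
      rw [div_le_iff_of_neg this, hw]
      push_cast
      nlinarith
    · have hb2' : (2 : ℝ) ≤ b := by exact_mod_cast hb2
      have : 0 < μ + b := by linarith
      refine ⟨this.ne', Or.inr ⟨?_, ?_⟩⟩
      · rw [lt_div_iff₀ this]
        linarith
      · rw [div_lt_iff₀ this, hw]
        nlinarith
  obtain ⟨hd0, hd⟩ := hd
  refine ⟨hlt.ne, hd0, ?_⟩
  have key : ∀ q : ℝ, w < q → q ≠ 0 ∧ q⁻¹ ∈ {r | r = 1 ∨ r < w⁻¹} := fun q hq =>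
    ⟨by linarith, Or.inr ((inv_lt_inv₀ (by linarith) hw0).2 hq)⟩
  have key' : ∀ q : ℝ, q < 0 → q ≠ 0 ∧ q⁻¹ ∈ {r | r = 1 ∨ r < w⁻¹} := fun q hq =>
    ⟨hq.ne, Or.inr ((inv_lt_zero.2 hq).trans hwi0)⟩
  rcases hr with rfl | hr
  -- Here `1 - 2/w = 3 - 2√2 = 1 / (1 + 2w)`.
  · have hi : 1 + 2 * w ≤ (1 + a / (μ + 1 - a))⁻¹ := by
      rw [le_inv_comm₀ (by linarith) (by linarith)]
      have : (1 + 2 * w)⁻¹ = 3 - 2 * √2 := by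
        rw [hw]; exact inv_eq_of_mul_eq_one_right (by linear_combination (-4) * h2)
      rw [this]
      linarith
    refine ⟨by linarith, key _ ?_⟩
    rcases hd with hd | hd <;> linarith [hd]
  · have hneg : r + a / (μ + 1 - a) < -w⁻¹ := by linarith
    have hi0 : (r + a / (μ + 1 - a))⁻¹ < 0 := inv_lt_zero.2 (by linarith)
    refine ⟨by linarith, ?_⟩
    rcases hd with hd | hd
    · apply key
      have : -w < (r + a / (μ + 1 - a))⁻¹ := by
        have := (inv_lt_inv_of_neg (show -w⁻¹ < 0 by linarith) (by linarith)).2 hneg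
        rwa [inv_neg, inv_inv] at this
      linarith
    · exact key' _ (by linarith)

/-! ### From block equations to non-eigenvalues -/

/-- The block equations transport the ratio along a clique block `x` and an independent
block `y`. -/
theorem RatioInvariant.step {μ : ℝ} {P : ℕ → Prop} {R : Set ℝ} (hR : RatioInvariant μ P R)
    (h0 : μ ≠ 0) (h1 : μ ≠ -1) {a b : ℕ} (ha : P a) (hb : P b)
    (x : Fin a → ℝ) (y : Fin b → ℝ) (S T T' : ℝ)
    (hx : ∀ i, (μ + 1) * x i = ∑ i, x i + T) (hy : ∀ j, μ * y j = S + ∑ i, x i + T')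
    (hT : T = ∑ j, y j + T') (hST : T = 0 ∧ S = 0 ∨ T ≠ 0 ∧ (S + T) / T ∈ R)
    (h1R : (1 : ℝ) ∈ R) :
    T = 0 ∧ T' = 0 ∧ x = 0 ∧ y = 0 ∧ S = 0 ∨
      T' ≠ 0 ∧ (S + ∑ i, x i + ∑ j, y j + T') / T' ∈ R := by
  have hX : (μ + 1) * ∑ i, x i = a * (∑ i, x i + T) := by
    rw [Finset.mul_sum, Finset.sum_congr rfl fun i _ => hx i]; simp; ring
  have hY : μ * ∑ j, y j = b * (S + ∑ i, x i + T') := by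
    rw [Finset.mul_sum, Finset.sum_congr rfl fun i _ => hy i]; simp; ring
  generalize hXd : ∑ i, x i = X at *
  generalize hYd : ∑ j, y j = Y at *
  have h1' : μ + 1 ≠ 0 := fun h => h1 (by linarith)
  rcases hST with ⟨hT0, hS⟩ | ⟨hT0, hr⟩
  -- The ratio is undefined when `T = 0`; the ratio `1` serves only to obtain the nonzero
  -- denominators, which force both blocks to vanish.
  · obtain ⟨e1, e2, -⟩ := hR a b ha hb 1 h1R
    have hX0 : X = 0 := by
      have : (μ + 1 - a) * X = 0 := by rw [hT0] at hX; linear_combination hX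
      exact (mul_eq_zero.1 this).resolve_left e1
    have hY0 : Y = 0 := by
      have : (μ + b) * Y = 0 := by
        linear_combination hY + b * hS + b * hX0 - b * hT + b * hT0
      exact (mul_eq_zero.1 this).resolve_left e2
    have hT' : T' = 0 := by linarith
    refine Or.inl ⟨hT0, hT', ?_, ?_, hS⟩
    · funext i
      have := hx i
      rw [hX0, hT0, add_zero] at this
      exact (mul_eq_zero.1 this).resolve_left h1'
    · funext j
      have := hy j
      rw [hS, hX0, hT', add_zero, add_zero] at this
      exact (mul_eq_zero.1 this).resolve_left h0
  · obtain ⟨e1, e2, e3, e4, e5⟩ := hR a b ha hb _ hr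
    right
    have hXe : X = a / (μ + 1 - a) * T := by
      field_simp
      linear_combination hX
    have hU : (S + T) / T + a / (μ + 1 - a) = (S + T + X) / T := by
      rw [hXe]; field_simp
    have hYe : Y = b / (μ + b) * (S + T + X) := by
      field_simp
      linear_combination hY - b * hT
    rw [hU] at e3 e4 e5
    have hU0 : S + T + X ≠ 0 := fun h => e3 (by rw [h, zero_div])
    have hq : ((S + T + X) / T)⁻¹ - b / (μ + b) = T' / (S + T + X) := by
      rw [inv_div, eq_div_iff hU0, sub_mul, div_mul_cancel₀ _ hU0, ← hYe, hT]; ring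
    rw [hq] at e4 e5
    refine ⟨fun h => e4 (by rw [h, zero_div]), ?_⟩
    rw [inv_div] at e5
    convert e5 using 2
    rw [hT]; ring

open Classical in
/-- The vector `v` solves the eigenvalue equation for `μ` up to the constant `t`. -/
def SolvesShifted {V : Type*} [Fintype V] (G : SimpleGraph V) (μ t : ℝ) (v : V → ℝ) : Prop :=
  ∀ x, (∑ y, if G.Adj x y then v y else 0) + t = μ * v x

/-- Solutions of the shifted eigenvalue equation vanish or have ratio in `R`. -/
def HasRatiosIn {V : Type*} [Fintype V] (G : SimpleGraph V) (μ : ℝ) (R : Set ℝ) : Prop :=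
  ∀ t v, SolvesShifted G μ t v → t = 0 ∧ v = 0 ∨ t ≠ 0 ∧ (∑ x, v x + t) / t ∈ R

theorem sum_ne_eq_sub {V : Type*} [Fintype V] [DecidableEq V] (v : V → ℝ) (i : V) :
    (∑ j, if i = j then 0 else v j) = ∑ j, v j - v i := by
  have : ∀ j, (if i = j then 0 else v j) = v j - if i = j then v j else 0 := by
    intro j; split_ifs <;> simp
  simp [this, Finset.sum_sub_distrib]

theorem hasRatiosIn_base {μ : ℝ} {P : ℕ → Prop} {R : Set ℝ} (hR : RatioInvariant μ P R)
    (h0 : μ ≠ 0) (h1 : μ ≠ -1) (h1R : (1 : ℝ) ∈ R) {a b : ℕ} (ha : P a) (hb : P b) :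
    HasRatiosIn ((⊥ : SimpleGraph (Fin a)) ⊕g (⊤ : SimpleGraph (Fin b)))ᶜ μ R := by
  classical
  intro t v hv
  have hx := fun i => hv (Sum.inl i)
  have hy := fun j => hv (Sum.inr j)
  simp [Fintype.sum_sum_type, SimpleGraph.sum, sum_ne_eq_sub] at hx hy
  rcases hR.step h0 h1 ha hb (v ∘ Sum.inl) (v ∘ Sum.inr) 0 (∑ j, v (Sum.inr j) + t) t
    (fun i => by simp only [Function.comp]; linarith [hx i])
    (fun j => by simp only [Function.comp]; linarith [hy j]) rfl
    (by by_cases h : ∑ j, v (Sum.inr j) + t = 0 <;> simp [h, h1R]) h1R with h | h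
  · refine Or.inl ⟨h.2.1, ?_⟩
    ext (i | j)
    · exact congrFun h.2.2.1 i
    · exact congrFun h.2.2.2.1 j
  · refine Or.inr ⟨h.1, ?_⟩
    simpa [Fintype.sum_sum_type] using h.2

theorem HasRatiosIn.succ {μ : ℝ} {P : ℕ → Prop} {R : Set ℝ} (hR : RatioInvariant μ P R)
    (h0 : μ ≠ 0) (h1 : μ ≠ -1) (h1R : (1 : ℝ) ∈ R) {a b : ℕ} (ha : P a) (hb : P b)
    {V : Type*} [Fintype V] {G : SimpleGraph V} (hG : HasRatiosIn G μ R) :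
    HasRatiosIn ((G ⊕g (⊤ : SimpleGraph (Fin a)))ᶜ ⊕g (⊤ : SimpleGraph (Fin b)))ᶜ μ R := by
  classical
  intro t v hv
  have hz := fun i => hv (Sum.inl (Sum.inl i))
  have hx := fun i => hv (Sum.inl (Sum.inr i))
  have hy := fun j => hv (Sum.inr j)
  -- The two complements cancel inside the inner graph and inside the clique block.
  have hadj : ∀ i j, (¬ i = j ∧ (i = j ∨ G.Adj i j)) ↔ G.Adj i j := fun i j =>
    ⟨fun h => h.2.resolve_left h.1, fun h => ⟨h.ne, Or.inr h⟩⟩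
  have hadj' : ∀ i j : Fin a, (¬ i = j ∧ (i = j ∨ ¬ i = j)) ↔ ¬ i = j := by tauto
  simp [Fintype.sum_sum_type, SimpleGraph.sum, sum_ne_eq_sub, imp_iff_not_or, hadj, hadj']
    at hx hy hz
  have hin := hG (∑ j, v (Sum.inr j) + t) (fun i => v (Sum.inl (Sum.inl i)))
    (fun i => by rw [← hz i]; ring)
  rcases hR.step h0 h1 ha hb (fun i => v (Sum.inl (Sum.inr i))) (v ∘ Sum.inr)
    (∑ i, v (Sum.inl (Sum.inl i))) (∑ j, v (Sum.inr j) + t) t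
    (fun i => by linarith [hx i])
    (fun j => by simp only [Function.comp]; linarith [hy j]) rfl
    (hin.imp (fun h => ⟨h.1, by simp [fun i => congrFun h.2 i]⟩) id) h1R with h | h
  · refine Or.inl ⟨h.2.1, ?_⟩
    ext ((i | i) | j)
    · exact congrFun (hin.resolve_right fun h' => h'.1 h.1).2 i
    · exact congrFun h.2.2.1 i
    · exact congrFun h.2.2.2.1 j
  · refine Or.inr ⟨h.1, ?_⟩
    simpa [Fintype.sum_sum_type] using h.2

theorem cGraph_hasRatiosIn {μ : ℝ} {P : ℕ → Prop} {R : Set ℝ} (hR : RatioInvariant μ P R)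
    (h0 : μ ≠ 0) (h1 : μ ≠ -1) (h1R : (1 : ℝ) ∈ R) (α : ℕ → ℕ) (n : ℕ)
    (hα : ∀ i ∈ Set.Icc 1 (2 * (n + 1)), P (α i)) :
    HasRatiosIn (CGraph α (2 * (n + 1))) μ R := by
  induction n with
  | zero => exact hasRatiosIn_base hR h0 h1 h1R (hα 1 (by simp)) (hα 2 (by simp))
  | succ n ih =>
    exact HasRatiosIn.succ hR h0 h1 h1R (hα (2 * n + 3) (by simp; lia))
      (hα (2 * n + 4) (by simp; lia)) (ih fun i hi => hα i ⟨hi.1, by have := hi.2; lia⟩)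

theorem not_mem_adjEigenvalues_of_hasRatiosIn {V : Type*} [Fintype V] {G : SimpleGraph V}
    {μ : ℝ} {R : Set ℝ} (h : HasRatiosIn G μ R) : μ ∉ adjEigenvalues G := by
  classical
  intro hμ
  obtain ⟨v, hv⟩ := Module.End.HasEigenvalue.exists_hasEigenvector hμ
  refine (h 0 v fun x => ?_).elim (fun h => hv.2 h.2) fun h => h.1 rfl
  have := congrFun hv.apply_eq_smul x
  simpa [Matrix.mulVec, dotProduct, SimpleGraph.adjMatrix_apply] using this

theorem cGraph_not_mem_Icc (n : ℕ) (α : ℕ → ℕ)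
    (hα : ∀ i ∈ Set.Icc 1 (2 * (n + 1)), 1 ≤ α i) (c : ℕ)
    (hc : ∀ i ∈ Set.Icc 1 (2 * (n + 1)), c ≤ α i) {μ : ℝ}
    (hμ : μ ∈ adjEigenvalues (CGraph α (2 * (n + 1)))) (h0 : μ ≠ 0) (h1 : μ ≠ -1) :
    μ ∉ Set.Icc ((-1 - √2) / 2) ((-1 + √2) / 2 * (c : ℝ)) := by
  rintro ⟨hl, hu⟩
  have hs : 0 ≤ (-1 + √2) / 2 := by
    have : (1 : ℝ) ≤ √2 := Real.one_le_sqrt.2 (by norm_num)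
    linarith
  rcases lt_or_gt_of_ne h0 with h | h
  · rcases lt_or_gt_of_ne h1 with h' | h'
    · exact not_mem_adjEigenvalues_of_hasRatiosIn
        (cGraph_hasRatiosIn (ratioInvariant_of_lt_neg_one h' hl rfl) h0 h1 (Or.inl rfl) α n hα) hμ
    · exact not_mem_adjEigenvalues_of_hasRatiosIn
        (cGraph_hasRatiosIn (ratioInvariant_of_mem_Ioo h' h) h0 h1 (Or.inl rfl) α n hα) hμ
  · refine not_mem_adjEigenvalues_of_hasRatiosIn
      (cGraph_hasRatiosIn (ratioInvariant_of_pos h rfl rfl) h0 h1 (Or.inl rfl) α n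
        fun i hi => ⟨hα i hi, hu.trans ?_⟩) hμ
    exact mul_le_mul_of_nonneg_left (by exact_mod_cast hc i hi) hs

/-! ### Existence of eigenvalues by Rayleigh quotients -/

theorem Matrix.IsHermitian.exists_hasEigenvalue_lt {V : Type*} [Fintype V] [DecidableEq V]
    {M : Matrix V V ℝ} (hM : M.IsHermitian) (c : ℝ) (v : V → ℝ)
    (hv : v ⬝ᵥ M.mulVec v < c * (v ⬝ᵥ v)) :
    ∃ μ, Module.End.HasEigenvalue (Matrix.toLin' M) μ ∧ μ < c := by
  have hN : (M - c • (1 : Matrix V V ℝ)).IsHermitian :=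
    hM.sub (by simp [Matrix.IsHermitian])
  have hneg : ¬ (M - c • (1 : Matrix V V ℝ)).PosSemidef := fun h => by
    have := h.dotProduct_mulVec_nonneg v
    simp [Matrix.sub_mulVec, Matrix.smul_mulVec] at this
    linarith
  rw [hN.posSemidef_iff_eigenvalues_nonneg, Pi.le_def] at hneg
  push Not at hneg
  obtain ⟨i, hi⟩ := hneg
  refine ⟨hN.eigenvalues i + c, ?_, by simpa using hi⟩
  refine Module.End.hasEigenvalue_of_hasEigenvector (x := hN.eigenvectorBasis i) ⟨?_, ?_⟩
  · rw [Module.End.mem_eigenspace_iff, Matrix.toLin'_apply]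
    have := hN.mulVec_eigenvectorBasis i
    rw [Matrix.sub_mulVec, Matrix.smul_mulVec, Matrix.one_mulVec, sub_eq_iff_eq_add] at this
    rw [this, add_smul]
  · intro h
    apply hN.eigenvectorBasis.toBasis.ne_zero i
    ext j
    simpa using congrFun h j

theorem exists_pos_mem_adjEigenvalues {V : Type*} [Fintype V] {G : SimpleGraph V} {x y : V}
    (h : G.Adj x y) : ∃ μ ∈ adjEigenvalues G, 0 < μ := by
  classical
  have hA : (-(G.adjMatrix ℝ)).IsHermitian := (G.isHermitian_adjMatrix ℝ).neg
  obtain ⟨μ, hμ, hlt⟩ := hA.exists_hasEigenvalue_lt 0 (Pi.single x 1 + Pi.single y 1) (by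
    simp [Matrix.mulVec_add, add_dotProduct, h, h.symm])
  refine ⟨-μ, ?_, by linarith⟩
  obtain ⟨v, hv⟩ := hμ.exists_hasEigenvector
  have hv' := hv.apply_eq_smul
  rw [Matrix.toLin'_apply, Matrix.neg_mulVec] at hv'
  have : Module.End.HasEigenvalue (Matrix.toLin' (G.adjMatrix ℝ)) (-μ) :=
    Module.End.hasEigenvalue_of_hasEigenvector (x := v)
      ⟨by rw [Module.End.mem_eigenspace_iff, Matrix.toLin'_apply, neg_smul, ← hv', neg_neg], hv.2⟩
  unfold adjEigenvalues
  convert this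

theorem exists_lt_neg_one_mem_adjEigenvalues {V : Type*} [Fintype V] {G : SimpleGraph V}
    {x y z : V} (hxy : G.Adj x y) (hyz : G.Adj y z) (hxz : ¬ G.Adj x z) (hne : x ≠ z) :
    ∃ μ ∈ adjEigenvalues G, μ < -1 := by
  classical
  have hA : (G.adjMatrix ℝ).IsHermitian := G.isHermitian_adjMatrix ℝ
  have hzx : ¬ G.Adj z x := fun h => hxz h.symm
  obtain ⟨μ, hμ, hlt⟩ := hA.exists_hasEigenvalue_lt (-1)
    -- On the path the quadratic form is `-4` and the squared norm `3`, and `-4/3 < -1`.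
    (Pi.single x 1 + Pi.single z 1 - Pi.single y 1) (by
    simp [Matrix.mulVec_add, Matrix.mulVec_sub, add_dotProduct, sub_dotProduct, hxy, hxy.symm,
      hyz, hyz.symm, hxz, hzx, hne, hne.symm, hxy.ne, hxy.ne.symm, hyz.ne, hyz.ne.symm]
    norm_num)
  refine ⟨μ, ?_, hlt⟩
  unfold adjEigenvalues
  convert hμ

theorem finite_adjEigenvalues {V : Type*} [Fintype V] (G : SimpleGraph V) :
    (adjEigenvalues G).Finite :=
  Module.End.finite_hasEigenvalue _

theorem compl_sum_adj_inl_inr {V W : Type*} {G : SimpleGraph V} {H : SimpleGraph W} (x : V)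
    (y : W) : (G ⊕g H)ᶜ.Adj (Sum.inl x) (Sum.inr y) := by
  simp [SimpleGraph.sum]

theorem cGraph_exists_adj (n : ℕ) (α : ℕ → ℕ)
    (hα : ∀ i ∈ Set.Icc 1 (2 * (n + 1)), 1 ≤ α i) :
    ∃ x y, (CGraph α (2 * (n + 1))).Adj x y := by
  have h : Nonempty (CVertex α (2 * n + 1)) := by
    cases n with
    | zero => exact ⟨(⟨0, hα 1 (by simp)⟩ : Fin (α 1))⟩
    | succ n => exact ⟨(Sum.inr ⟨0, hα (2 * n + 3) (by simp; lia)⟩ : _ ⊕ Fin (α (2 * n + 3)))⟩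
  obtain ⟨x⟩ := h
  refine ⟨(Sum.inl x : CVertex α (2 * n + 1) ⊕ Fin (α (2 * n + 2))),
    Sum.inr ⟨0, hα (2 * n + 2) (by simp; lia)⟩, ?_⟩
  exact compl_sum_adj_inl_inr _ _

/-- For one pair of blocks, the ends are two independent vertices and the middle lies in the clique.
Otherwise the last block supplies the middle, joined to an inner vertex and a clique vertex that are
not adjacent. -/
theorem cGraph_exists_induced_path (n : ℕ) (α : ℕ → ℕ)
    (hα : ∀ i ∈ Set.Icc 1 (2 * (n + 1)), 1 ≤ α i) (h : ¬ (n = 0 ∧ α 2 = 1)) :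
    ∃ x y z, (CGraph α (2 * (n + 1))).Adj x y ∧ (CGraph α (2 * (n + 1))).Adj y z ∧
      ¬ (CGraph α (2 * (n + 1))).Adj x z ∧ x ≠ z := by
  cases n with
  | zero =>
    have h2 : 2 ≤ α 2 := by
      have := hα 2 (by simp)
      lia
    have hne : (⟨0, by lia⟩ : Fin (α 2)) ≠ ⟨1, h2⟩ := by simp
    refine ⟨(Sum.inr ⟨0, by lia⟩ : Fin (α 1) ⊕ Fin (α 2)), Sum.inl ⟨0, hα 1 (by simp)⟩,
      Sum.inr ⟨1, h2⟩, (compl_sum_adj_inl_inr _ _).symm, compl_sum_adj_inl_inr _ _, fun h => h.2 hne, ?_⟩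
    exact fun h => hne (Sum.inr_injective h)
  | succ n =>
    obtain ⟨x, -, -⟩ := cGraph_exists_adj n α fun i hi => hα i ⟨hi.1, by have := hi.2; lia⟩
    let W := CVertex α (2 * (n + 1)) ⊕ Fin (α (2 * n + 3))
    let u : W := Sum.inl x
    let u' : W := Sum.inr ⟨0, hα (2 * n + 3) (by simp; lia)⟩
    have hne : u ≠ u' := Sum.inl_ne_inr
    refine ⟨(Sum.inl u : W ⊕ Fin (α (2 * n + 4))), Sum.inr ⟨0, hα (2 * n + 4) (by simp; lia)⟩,
      Sum.inl u', compl_sum_adj_inl_inr _ _, (compl_sum_adj_inl_inr _ _).symm, fun h => h.2 (compl_sum_adj_inl_inr _ _), ?_⟩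
    exact fun h => hne (Sum.inl_injective h)

theorem mainTheorem1 (k : ℕ) (hk : 1 ≤ k) (α : ℕ → ℕ)
    (hα : ∀ i ∈ Set.Icc 1 (2 * k), 1 ≤ α i)
    (αmin : ℕ) (hmin : IsLeast (α '' Set.Icc 1 (2 * k)) αmin) :
    (∀ l : ℝ, IsGreatest {μ | μ ∈ adjEigenvalues (CGraph α (2 * k)) ∧ μ < -1} l →
      l < (-1 - √2) / 2) ∧
    (¬ (k = 1 ∧ α 2 = 1) →
      ∃ l : ℝ, IsGreatest {μ | μ ∈ adjEigenvalues (CGraph α (2 * k)) ∧ μ < -1} l) ∧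
    (∃ l : ℝ, IsLeast {μ | μ ∈ adjEigenvalues (CGraph α (2 * k)) ∧ 0 < μ} l ∧
      (-1 + √2) / 2 * (αmin : ℝ) < l) ∧
    (∀ μ ∈ adjEigenvalues (CGraph α (2 * k)), μ ≠ 0 → μ ≠ -1 →
      μ ∉ Set.Icc ((-1 - √2) / 2) ((-1 + √2) / 2 * (αmin : ℝ))) := by
  obtain ⟨n, rfl⟩ : ∃ n, k = n + 1 := ⟨k - 1, by lia⟩
  have key := fun μ hμ h0 h1 => cGraph_not_mem_Icc n α hα αmin
    (fun i hi => hmin.2 (Set.mem_image_of_mem α hi)) (μ := μ) hμ h0 h1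
  have h1 : (1 : ℝ) ≤ √2 := Real.one_le_sqrt.2 (by norm_num)
  have hs : 0 ≤ (-1 + √2) / 2 * (αmin : ℝ) := mul_nonneg (by linarith) (Nat.cast_nonneg _)
  refine ⟨fun l hl => ?_, fun h => ?_, ?_, key⟩
  · obtain ⟨⟨hl, hlt⟩, -⟩ := hl
    by_contra! hge
    exact key l hl (by linarith) hlt.ne ⟨hge, by linarith⟩
  · obtain ⟨x, y, z, hxy, hyz, hxz, hne⟩ := cGraph_exists_induced_path n α hα (by simpa using h)
    obtain ⟨μ, hμ⟩ := exists_lt_neg_one_mem_adjEigenvalues hxy hyz hxz hne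
    obtain ⟨l, hl⟩ := ((finite_adjEigenvalues (CGraph α (2 * (n + 1)))).subset
      fun _ h => h.1).exists_maximal (s := {μ | μ ∈ adjEigenvalues _ ∧ μ < -1}) ⟨μ, hμ⟩
    exact ⟨l, hl.1, fun b hb => (le_total b l).elim id (hl.2 hb)⟩
  · obtain ⟨x, y, hxy⟩ := cGraph_exists_adj n α hα
    obtain ⟨μ, hμ⟩ := exists_pos_mem_adjEigenvalues hxy
    obtain ⟨l, hl⟩ := ((finite_adjEigenvalues (CGraph α (2 * (n + 1)))).subset
      fun _ h => h.1).exists_minimal (s := {μ | μ ∈ adjEigenvalues _ ∧ 0 < μ}) ⟨μ, hμ⟩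
    refine ⟨l, ⟨hl.1, fun b hb => (le_total l b).elim id (hl.2 hb)⟩, ?_⟩
    obtain ⟨hle, hpos⟩ := hl.1
    by_contra! hge
    exact key l hle hpos.ne' (by linarith) ⟨by linarith, hge⟩
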